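/- Let $(X,d)$ be a proper geodesic Gromov hyperbolic metric space, with Gromov boundary $\partial_G X$ (the geodesic rays $[0,+\infty)\to X$ modulo staying at bounded distance) and Gromov compactification $\overline X^G = X\sqcup\partial_G X$. The endpoint of a geodesic ray is its class in $\partial_GX$. Let $f\colon X\to X$ be non-expanding, i.e. $d(f(x),f(y))\le d(x,y)$ for all $x,y\in X$, and let $\eta\in\partial_G X$. For $p\in X$ the dilation $\lambda_{\eta,p}\in(0,+\infty]$ of $f$ at $\eta$ is defined by $$\log\lambda_{\eta,p}=\liminf_{z\to\eta}\bigl(d(z,p)-d(f(z),p)\bigr);$$ whether it is finite does not depend on $p$. The point $\eta$ is a *boundary regular fixed point* (BRFP) of $f$ if $\lambda_{\eta,p}<+\infty$ and $f$ has geodesic limit $\eta$ at $\eta$, that is, $f(x_n)\to\eta$ for every sequence $(x_n)$ in $X$ that converges to $\eta$ and is contained in some set $\{x\in X: d(x,\gamma)<R\}$, where $R>0$ and $\gamma$ is a geodesic ray with endpoint $\eta$. For $B\ge 0$, a curve $\sigma\colon[0,+\infty)\to X$ is a $(1,B)$-quasi-geodesic if $|t-s|-B\le d(\sigma(s),\sigma(t))\le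 |t-s|+B$ for all $s,t\ge 0$; it has endpoint $\eta$ if $\sigma(t)\to\eta$ in $\overline X^G$ as $t\to+\infty$. Then the following are equivalent: 1. $\eta$ is a BRFP of $f$; 2. there exists a geodesic ray $\gamma$ with endpoint $\eta$ such that the curve $f\circ\gamma$ is, for some $B\ge 0$, a $(1,B)$-quasi-geodesic with endpoint $\eta$; 3. there exists a geodesic ray $\gamma$ with endpoint $\eta$ such that $\limsup_{t\to+\infty} d(\gamma(t),f(\gamma(t)))<+\infty$; 4. $\liminf_{z\to\eta} d(z,f(z))<+\infty$. -/

import Mathlib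

open Set Filter Topology
open scoped NNReal ENNReal

namespace GromovHyp

/-- `S` is (the image of) a geodesic segment from `x` to `y`. -/
def IsGeodesicSegment {X : Type*} [MetricSpace X] (S : Set X) (x y : X) : Prop :=
  ∃ c : ℝ → X, c 0 = x ∧ c (dist x y) = y ∧
    (∀ s ∈ Icc 0 (dist x y), ∀ t ∈ Icc 0 (dist x y), dist (c s) (c t) = |s - t|) ∧
    S = c '' Icc 0 (dist x y)

/-- Geodesic metric space: any two points are joined by a geodesic segment. -/
def IsGeodesicSpace (X : Type*) [MetricSpace X] : Prop :=
  ∀ x y : X, ∃ S : Set X, IsGeodesicSegment S x y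

/-- Thin triangles: every side of every geodesic triangle lies in the `δ`-neighbourhood of the
union of the two other sides. (All sides are covered, as the vertices can be permuted.) -/
def IsDeltaHyperbolic (X : Type*) [MetricSpace X] (δ : ℝ) : Prop :=
  ∀ (x y z : X) (S₁ S₂ S₃ : Set X),
    IsGeodesicSegment S₁ x y → IsGeodesicSegment S₂ y z → IsGeodesicSegment S₃ z x →
    S₁ ⊆ Metric.thickening δ (S₂ ∪ S₃)

/-- Gromov hyperbolicity (used for proper geodesic spaces). -/
def IsGromovHyperbolic (X : Type*) [MetricSpace X] : Prop :=
  ∃ δ : ℝ, 0 < δ ∧ IsDeltaHyperbolic X δ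

/-- Geodesic rays: isometric embeddings of `[0, ∞)`. -/
def GeodesicRay (X : Type*) [MetricSpace X] : Type _ :=
  {γ : ℝ≥0 → X // Isometry γ}

instance {X : Type*} [MetricSpace X] : CoeFun (GeodesicRay X) (fun _ => ℝ≥0 → X) :=
  ⟨fun γ => γ.1⟩

/-- Two geodesic rays are asymptotic if they stay at bounded distance. -/
def Asymptotic {X : Type*} [MetricSpace X] (γ σ : GeodesicRay X) : Prop :=
  ∃ K : ℝ, ∀ t : ℝ≥0, dist (γ t) (σ t) ≤ K

/-- Being asymptotic is an equivalence relation. -/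
def asymptoticSetoid (X : Type*) [MetricSpace X] : Setoid (GeodesicRay X) where
  r := Asymptotic
  iseqv :=
    { refl := fun γ => ⟨0, fun t => by simp⟩
      symm := fun ⟨K, h⟩ => ⟨K, fun t => by rw [dist_comm]; exact h t⟩
      trans := fun ⟨K, h⟩ ⟨L, k⟩ =>
        ⟨K + L, fun t => (dist_triangle _ _ _).trans (add_le_add (h t) (k t))⟩ }

/-- The Gromov boundary: geodesic rays modulo being asymptotic. -/
def GromovBoundary (X : Type*) [MetricSpace X] : Type _ :=
  Quotient (asymptoticSetoid X)

/-- The endpoint `γ(+∞)` of a geodesic ray. -/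
def GeodesicRay.endpoint {X : Type*} [MetricSpace X] (γ : GeodesicRay X) : GromovBoundary X :=
  Quotient.mk (asymptoticSetoid X) γ

/-- The set underlying the Gromov compactification: the disjoint union of `X` and its
Gromov boundary. -/
inductive GromovCompactification (X : Type*) [MetricSpace X] where
  | point : X → GromovCompactification X
  | bdry : GromovBoundary X → GromovCompactification X

/-- The Gromov product `(x, y)_p`. -/
noncomputable def gromovProduct {X : Type*} [MetricSpace X] (p x y : X) : ℝ :=
  (dist x p + dist y p - dist x y) / 2

/-- The curves representing a point of the compactification: the constant curve for a point of
`X`, the geodesic rays in the class for a boundary point. -/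
def GromovCompactification.reps {X : Type*} [MetricSpace X] :
    GromovCompactification X → Set (ℝ≥0 → X)
  | .point x => {fun _ => x}
  | .bdry η => {c | ∃ γ : GeodesicRay X, γ.endpoint = η ∧ c = γ}

/-- Basic neighbourhoods of a boundary point `η`: the points `z` of the compactification whose
Gromov product with `η` based at `p`, that is, the infimum over representatives `σ` of `z` and
`γ` of `η` of `liminf_{s,t → ∞} (σ(s), γ(t))_p`, is large. -/
def basicNhd {X : Type*} [MetricSpace X] (η : GromovBoundary X) (p : X) (R : ℝ) :
    Set (GromovCompactification X) :=
  {z | ∀ σ ∈ z.reps, ∀ γ ∈ (GromovCompactification.bdry η).reps,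
    ∀ᶠ st : ℝ≥0 × ℝ≥0 in atTop ×ˢ atTop, R ≤ gromovProduct p (σ st.1) (γ st.2)}

/-- Neighbourhood filters of the Gromov compactification. Changing the base point `p` changes
Gromov products by a bounded amount, so that every single `p` would give the same filter. -/
def gromovNhds {X : Type*} [MetricSpace X] :
    GromovCompactification X → Filter (GromovCompactification X)
  | .point x => map GromovCompactification.point (𝓝 x)
  | .bdry η => ⨅ (p : X) (R : ℝ), 𝓟 (basicNhd η p R)

/-- The topology of the Gromov compactification: a set is open if it belongs to `gromovNhds z`
for each of its points `z`. -/
instance {X : Type*} [MetricSpace X] : TopologicalSpace (GromovCompactification X) :=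
  TopologicalSpace.mkOfNhds gromovNhds

/-- The filter on `X` describing `z → η`, for `z` in `X` and `η` in the Gromov boundary. -/
def toBoundary {X : Type*} [MetricSpace X] (η : GromovBoundary X) : Filter X :=
  comap GromovCompactification.point (𝓝 (GromovCompactification.bdry η))

/-- `(A, B)`-quasi-geodesic rays (for `A ≥ 1`, `B ≥ 0`). -/
def IsQuasiGeodesicRay {X : Type*} [MetricSpace X] (A B : ℝ) (c : ℝ≥0 → X) : Prop :=
  ∀ s t : ℝ≥0, A⁻¹ * |(t : ℝ) - s| - B ≤ dist (c s) (c t) ∧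
    dist (c s) (c t) ≤ A * |(t : ℝ) - s| + B

/-- The geodesic region `A(γ, R)`. -/
def geodesicRegion {X : Type*} [MetricSpace X] (γ : GeodesicRay X) (R : ℝ) : Set X :=
  {x | Metric.infDist x (range γ) < R}

/-- `F` has geodesic limit `ξ` at `η`: `F (x n) → ξ` for every sequence `x` converging to `η`
inside some geodesic region with vertex `η`. -/
def HasGeodesicLimit {X Y : Type*} [MetricSpace X] [TopologicalSpace Y] (F : X → Y)
    (η : GromovBoundary X) (ξ : Y) : Prop :=
  ∀ x : ℕ → X,
    Tendsto (fun n => GromovCompactification.point (x n)) atTop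
      (𝓝 (GromovCompactification.bdry η)) →
    (∃ (γ : GeodesicRay X) (R : ℝ), γ.endpoint = η ∧ 0 < R ∧ ∀ n, x n ∈ geodesicRegion γ R) →
    Tendsto (fun n => F (x n)) atTop (𝓝 ξ)

/-- The dilation `λ_{η,p} ∈ (0, ∞]` of `f` at `η` with respect to `p`, given by
`log λ_{η,p} = liminf_{z → η} (d(z, p) - d(f(z), p))`. -/
noncomputable def dilation {X : Type*} [MetricSpace X] (f : X → X) (η : GromovBoundary X)
    (p : X) : ℝ≥0∞ :=
  EReal.exp (liminf (fun z : X => ((dist z p - dist (f z) p : ℝ) : EReal)) (toBoundary η))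

/-- Boundary regular fixed points: the dilation is finite (for each base point; finiteness does
not depend on it) and `f` has geodesic limit `η` at `η`. -/
def IsBRFP {X : Type*} [MetricSpace X] (f : X → X) (η : GromovBoundary X) : Prop :=
  (∀ p : X, dilation f η p < ⊤) ∧
    HasGeodesicLimit (fun x => GromovCompactification.point (f x)) η
      (GromovCompactification.bdry η)

end GromovHyp

/-! Everything is read off from the Gromov product of a point `x` with the endpoint of a geodesic
ray `γ`, based at `γ 0`. In a space satisfying Gromov's four-point inequality, tending to the
endpoint means that this product tends to infinity, and a point `x` whose product with the endpoint
is at least `t` satisfies `d(x, γ t) ≤ d(x, γ 0) - t + O(1)`.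

Let `z → γ(∞)` with `d(z, γ 0) - d(f z, γ 0)` bounded. For a fixed `t` this gives
`d(f z, f (γ t)) ≤ d(z, γ t) ≤ d(f z, γ 0) - t + O(1)`, so the Gromov product of `f z` and `f (γ t)`
is at least `t - O(1)`. Hence `f z → γ(∞)` as soon as `f (γ t) → γ(∞)`; and once `f z → γ(∞)`, the
product of `f (γ t)` with the endpoint is at least `t - O(1)`, which together with
`d(f (γ t), γ 0) ≤ t + O(1)` bounds `d(γ t, f (γ t))`. -/

namespace GromovHyp

variable {X Y : Type*} [MetricSpace X] [MetricSpace Y]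

section GromovProduct

theorem gromovProduct_comm (p x y : X) : gromovProduct p x y = gromovProduct p y x := by
  simp only [gromovProduct, dist_comm x y, add_comm]

theorem gromovProduct_self (p x : X) : gromovProduct p x x = dist x p := by
  simp [gromovProduct]

theorem gromovProduct_le_dist (p x y : X) : gromovProduct p x y ≤ dist x p := by
  unfold gromovProduct
  linarith [dist_triangle_left y p x]

theorem dist_sub_dist_le_gromovProduct (p x y : X) :
    dist y p - dist x y ≤ gromovProduct p x y := by
  unfold gromovProduct
  linarith [dist_triangle_left y p x]

theorem gromovProduct_le_add_dist (p x x' y : X) :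
    gromovProduct p x y ≤ gromovProduct p x' y + dist x x' := by
  unfold gromovProduct
  linarith [dist_triangle x x' p, dist_triangle_left x' y x]

theorem gromovProduct_le_add_dist_base (p q x y : X) :
    gromovProduct p x y ≤ gromovProduct q x y + dist p q := by
  unfold gromovProduct
  linarith [dist_triangle_right x p q, dist_triangle_right y p q]

end GromovProduct

/-- Gromov's four-point condition with constant `κ`. Unlike the thinness of triangles, it makes
sense in spaces that need not be geodesic. -/
def IsFourPointHyperbolic (X : Type*) [MetricSpace X] (κ : ℝ) : Prop :=
  ∀ p x y z : X, min (gromovProduct p x y) (gromovProduct p y z) ≤ gromovProduct p x z + κ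

theorem IsFourPointHyperbolic.nonneg {κ : ℝ} (hX : IsFourPointHyperbolic X κ) (p : X) : 0 ≤ κ := by
  simpa [gromovProduct_self] using hX p p p p

section ThinTriangles

theorem IsGeodesicSegment.left_mem {S : Set X} {x y : X} (h : IsGeodesicSegment S x y) :
    x ∈ S := by
  obtain ⟨c, h0, -, -, rfl⟩ := h
  exact ⟨0, ⟨le_rfl, dist_nonneg⟩, h0⟩

theorem IsGeodesicSegment.right_mem {S : Set X} {x y : X} (h : IsGeodesicSegment S x y) :
    y ∈ S := by
  obtain ⟨c, -, h1, -, rfl⟩ := h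
  exact ⟨dist x y, ⟨dist_nonneg, le_rfl⟩, h1⟩

theorem IsGeodesicSegment.dist_add_dist {S : Set X} {x y w : X} (h : IsGeodesicSegment S x y)
    (hw : w ∈ S) : dist x w + dist w y = dist x y := by
  obtain ⟨c, h0, h1, hc, rfl⟩ := h
  obtain ⟨t, ht, rfl⟩ := hw
  have hxw := hc 0 ⟨le_rfl, dist_nonneg⟩ t ht
  have hwy := hc t ht (dist x y) ⟨dist_nonneg, le_rfl⟩
  rw [h0, zero_sub, abs_neg, abs_of_nonneg ht.1] at hxw
  rw [h1, abs_sub_comm, abs_of_nonneg (sub_nonneg.2 ht.2)] at hwy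
  linarith

theorem IsGeodesicSegment.isPreconnected {S : Set X} {x y : X} (h : IsGeodesicSegment S x y) :
    IsPreconnected S := by
  obtain ⟨c, -, -, hc, rfl⟩ := h
  refine isPreconnected_Icc.image c (LipschitzOnWith.continuousOn (K := 1) ?_)
  refine LipschitzOnWith.of_dist_le_mul fun s hs t ht => ?_
  rw [hc s hs t ht, NNReal.coe_one, one_mul, Real.dist_eq]

theorem IsGeodesicSegment.gromovProduct_le_dist {S : Set X} {x y w : X}
    (h : IsGeodesicSegment S x y) (hw : w ∈ S) (p : X) : gromovProduct p x y ≤ dist w p := by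
  unfold gromovProduct
  linarith [h.dist_add_dist hw, dist_triangle x w p, dist_triangle_left y p w]

theorem IsGeodesicSegment.dist_add_dist_le {S : Set X} {x y u : X} (h : IsGeodesicSegment S x y)
    (hu : u ∈ S) (w : X) : dist x w + dist w y ≤ dist x y + 2 * dist w u := by
  linarith [h.dist_add_dist hu, dist_triangle_right x w u, dist_triangle w u y]

/-- The side `S` is connected, so some point of it is `δ`-close to both other sides of the triangle
with third vertex `p`. -/
theorem IsDeltaHyperbolic.exists_mem_dist_le_gromovProduct {δ : ℝ} (hX : IsDeltaHyperbolic X δ)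
    (hδ : 0 < δ) (hgeo : IsGeodesicSpace X) {S : Set X} {x y : X} (h : IsGeodesicSegment S x y)
    (p : X) : ∃ w ∈ S, dist w p ≤ gromovProduct p x y + 2 * δ := by
  obtain ⟨S₂, h₂⟩ := hgeo y p
  obtain ⟨S₃, h₃⟩ := hgeo p x
  have hcover := hX x y p S S₂ S₃ h h₂ h₃
  rw [Metric.thickening_union] at hcover
  obtain ⟨w, hwS, hw₂, hw₃⟩ := h.isPreconnected _ _ Metric.isOpen_thickening
    Metric.isOpen_thickening hcover
    ⟨y, h.right_mem, Metric.self_subset_thickening hδ _ h₂.left_mem⟩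
    ⟨x, h.left_mem, Metric.self_subset_thickening hδ _ h₃.right_mem⟩
  obtain ⟨u, hu, hwu⟩ := Metric.mem_thickening_iff.1 hw₂
  obtain ⟨v, hv, hwv⟩ := Metric.mem_thickening_iff.1 hw₃
  refine ⟨w, hwS, ?_⟩
  have hyp := h₂.dist_add_dist_le hu w
  have hpx := h₃.dist_add_dist_le hv w
  rw [dist_comm y w] at hyp
  rw [dist_comm p w, dist_comm w x, dist_comm p x] at hpx
  unfold gromovProduct
  linarith [h.dist_add_dist hwS]

theorem IsDeltaHyperbolic.isFourPointHyperbolic {δ : ℝ} (hX : IsDeltaHyperbolic X δ) (hδ : 0 < δ)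
    (hgeo : IsGeodesicSpace X) : IsFourPointHyperbolic X (3 * δ) := by
  intro p x y z
  obtain ⟨S₁, h₁⟩ := hgeo x z
  obtain ⟨S₂, h₂⟩ := hgeo z y
  obtain ⟨S₃, h₃⟩ := hgeo y x
  obtain ⟨w, hw, hwp⟩ := hX.exists_mem_dist_le_gromovProduct hδ hgeo h₁ p
  obtain ⟨v, hv, hwv⟩ := Metric.mem_thickening_iff.1 (hX x z y S₁ S₂ S₃ h₁ h₂ h₃ hw)
  have hvp := dist_triangle_left v p w
  rw [gromovProduct_comm p x y, gromovProduct_comm p y z]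
  rcases hv with hv | hv
  · exact (min_le_right _ _).trans (by linarith [h₂.gromovProduct_le_dist hv p])
  · exact (min_le_left _ _).trans (by linarith [h₃.gromovProduct_le_dist hv p])

theorem IsGromovHyperbolic.exists_isFourPointHyperbolic (hhyp : IsGromovHyperbolic X)
    (hgeo : IsGeodesicSpace X) : ∃ κ : ℝ, IsFourPointHyperbolic X κ :=
  let ⟨δ, hδ, hX⟩ := hhyp
  ⟨3 * δ, hX.isFourPointHyperbolic hδ hgeo⟩

end ThinTriangles

section EndpointProduct

namespace GeodesicRay

theorem dist_eq (γ : GeodesicRay X) (s t : ℝ≥0) : dist (γ s) (γ t) = |(s : ℝ) - t| :=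
  γ.2.dist_eq s t

theorem dist_zero (γ : GeodesicRay X) (t : ℝ≥0) : dist (γ t) (γ 0) = t := by
  rw [γ.dist_eq, NNReal.coe_zero, sub_zero, NNReal.abs_eq]

theorem monotone_gromovProduct (γ : GeodesicRay X) (x : X) :
    Monotone fun t => gromovProduct (γ 0) x (γ t) := by
  intro s t hst
  have hst' : dist (γ s) (γ t) = t - s := by
    rw [γ.dist_eq, abs_sub_comm, abs_of_nonneg (sub_nonneg.2 (NNReal.coe_le_coe.2 hst))]
  simp only [gromovProduct, γ.dist_zero]
  linarith [dist_triangle x (γ s) (γ t)]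

theorem bddAbove_range_gromovProduct (γ : GeodesicRay X) (x : X) :
    BddAbove (range fun t => gromovProduct (γ 0) x (γ t)) :=
  ⟨dist x (γ 0), forall_mem_range.2 fun _ => gromovProduct_le_dist _ _ _⟩

/-- The Gromov product `(x, γ(+∞))` based at `γ 0`. As `(x, γ t)` is monotone in `t`, the supremum
is a limit; it is computed along `γ` itself and not minimized over all rays asymptotic to `γ`. -/
noncomputable def endpointProduct (γ : GeodesicRay X) (x : X) : ℝ :=
  ⨆ t, gromovProduct (γ 0) x (γ t)

theorem gromovProduct_le_endpointProduct (γ : GeodesicRay X) (x : X) (t : ℝ≥0) :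
    gromovProduct (γ 0) x (γ t) ≤ γ.endpointProduct x :=
  le_ciSup (γ.bddAbove_range_gromovProduct x) t

theorem tendsto_gromovProduct (γ : GeodesicRay X) (x : X) :
    Tendsto (fun t => gromovProduct (γ 0) x (γ t)) atTop (𝓝 (γ.endpointProduct x)) :=
  tendsto_atTop_ciSup (γ.monotone_gromovProduct x) (γ.bddAbove_range_gromovProduct x)

theorem endpointProduct_le_dist (γ : GeodesicRay X) (x : X) :
    γ.endpointProduct x ≤ dist x (γ 0) :=
  ciSup_le fun _ => gromovProduct_le_dist _ _ _

theorem endpointProduct_le_add_dist (γ : GeodesicRay X) (x y : X) :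
    γ.endpointProduct x ≤ γ.endpointProduct y + dist x y :=
  ciSup_le fun t => (gromovProduct_le_add_dist _ x y _).trans
    (add_le_add_left (γ.gromovProduct_le_endpointProduct y t) _)

theorem endpointProduct_apply (γ : GeodesicRay X) (t : ℝ≥0) : γ.endpointProduct (γ t) = t := by
  refine le_antisymm ((γ.endpointProduct_le_dist _).trans_eq (γ.dist_zero t)) ?_
  simpa only [gromovProduct_self, γ.dist_zero] using γ.gromovProduct_le_endpointProduct (γ t) t

end GeodesicRay

theorem tendsto_endpointProduct_of_asymptotic {γ σ : GeodesicRay X} (h : Asymptotic γ σ) :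
    Tendsto (fun t => γ.endpointProduct (σ t)) atTop atTop := by
  obtain ⟨K, hK⟩ := h
  have hcoe : Tendsto ((↑) : ℝ≥0 → ℝ) atTop atTop := NNReal.tendsto_coe_atTop.2 tendsto_id
  refine tendsto_atTop_mono (fun t => ?_) (tendsto_atTop_add_const_right atTop (-K) hcoe)
  have hdist := γ.endpointProduct_le_add_dist (γ t) (σ t)
  rw [γ.endpointProduct_apply] at hdist
  linarith [hK t]

theorem asymptotic_of_endpoint_eq {γ σ : GeodesicRay X} (h : γ.endpoint = σ.endpoint) :
    Asymptotic γ σ := Quotient.exact h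

theorem exists_endpoint_eq (η : GromovBoundary X) : ∃ γ : GeodesicRay X, γ.endpoint = η :=
  Quotient.exists_rep η

namespace IsFourPointHyperbolic

variable {κ : ℝ} (hX : IsFourPointHyperbolic X κ) (γ : GeodesicRay X)
include hX

theorem min_endpointProduct_le_gromovProduct (x y : X) :
    min (γ.endpointProduct x) (γ.endpointProduct y) ≤ gromovProduct (γ 0) x y + κ :=
  le_of_tendsto' ((γ.tendsto_gromovProduct x).min (γ.tendsto_gromovProduct y)) fun t => by
    simpa only [gromovProduct_comm (γ 0) y] using hX (γ 0) x (γ t) y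

theorem min_gromovProduct_le_endpointProduct (x y : X) :
    min (gromovProduct (γ 0) x y) (γ.endpointProduct y) ≤ γ.endpointProduct x + κ :=
  le_of_tendsto_of_tendsto' (tendsto_const_nhds.min (γ.tendsto_gromovProduct y))
    ((γ.tendsto_gromovProduct x).add_const κ) fun t => hX (γ 0) x y (γ t)

theorem tendsto_gromovProduct {ι : Type*} {l : Filter ι} {u v : ι → X}
    (hu : Tendsto (fun i => γ.endpointProduct (u i)) l atTop)
    (hv : Tendsto (fun i => γ.endpointProduct (v i)) l atTop) :
    Tendsto (fun i => gromovProduct (γ 0) (u i) (v i)) l atTop := by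
  refine tendsto_atTop.2 fun R => ?_
  filter_upwards [hu.eventually_ge_atTop (R + κ), hv.eventually_ge_atTop (R + κ)] with i hui hvi
  linarith [le_min hui hvi, hX.min_endpointProduct_le_gromovProduct γ (u i) (v i)]

/-- As if a geodesic from `γ 0` to `x` followed `γ` until time `γ.endpointProduct x` and then left
it. -/
theorem dist_ray_le (x : X) (t : ℝ≥0) :
    dist x (γ t) ≤ dist x (γ 0) + t - 2 * min (γ.endpointProduct x) t + 2 * κ := by
  have hprod := hX.min_endpointProduct_le_gromovProduct γ x (γ t)
  rw [γ.endpointProduct_apply, gromovProduct, γ.dist_zero] at hprod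
  linarith

end IsFourPointHyperbolic

end EndpointProduct

section Compactification

theorem basicNhd_anti (η : GromovBoundary X) (p : X) : Antitone (basicNhd η p) :=
  fun _ _ h _ hz σ hσ γ hγ => (hz σ hσ γ hγ).mono fun _ ht => h.trans ht

theorem basicNhd_add_dist_subset (η : GromovBoundary X) (p q : X) (R : ℝ) :
    basicNhd η p (R + dist p q) ⊆ basicNhd η q R := fun _ hz σ hσ γ hγ =>
  (hz σ hσ γ hγ).mono fun st ht => by
    linarith [gromovProduct_le_add_dist_base p q (σ st.1) (γ st.2)]

theorem hasBasis_gromovNhds_bdry (η : GromovBoundary X) (p : X) :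
    (gromovNhds (.bdry η)).HasBasis (fun _ : ℝ => True) (basicNhd η p) := by
  have hbase : gromovNhds (.bdry η) = ⨅ R : ℝ, 𝓟 (basicNhd η p R) := by
    refine le_antisymm (iInf_le _ p) (le_iInf fun q => le_iInf fun R => ?_)
    exact (iInf_le _ (R + dist p q)).trans
      (principal_mono.2 (basicNhd_add_dist_subset η p q R))
  rw [hbase]
  exact hasBasis_iInf_principal (basicNhd_anti η p).directed_ge

theorem point_mem_basicNhd_iff {η : GromovBoundary X} {p : X} {R : ℝ} {x : X} :
    .point x ∈ basicNhd η p R ↔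
      ∀ γ : GeodesicRay X, γ.endpoint = η → ∀ᶠ t in atTop, R ≤ gromovProduct p x (γ t) := by
  constructor
  · intro h γ hγ
    obtain ⟨_, ht⟩ := (h (fun _ => x) rfl γ ⟨γ, hγ, rfl⟩).curry.exists
    exact ht
  · rintro h _ rfl _ ⟨γ, hγ, rfl⟩
    exact tendsto_snd.eventually (h γ hγ)

theorem point_mem_basicNhd_of_dist_le {η : GromovBoundary X} {p x y : X} {R C : ℝ}
    (hx : .point x ∈ basicNhd η p (R + C)) (hxy : dist x y ≤ C) : .point y ∈ basicNhd η p R := by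
  rw [point_mem_basicNhd_iff] at hx ⊢
  refine fun γ hγ => (hx γ hγ).mono fun t ht => ?_
  linarith [gromovProduct_le_add_dist p x y (γ t)]

namespace IsFourPointHyperbolic

variable {κ : ℝ} (hX : IsFourPointHyperbolic X κ)
include hX

theorem bdry_mem_basicNhd (γ : GeodesicRay X) (R : ℝ) :
    .bdry γ.endpoint ∈ basicNhd γ.endpoint (γ 0) R := by
  rintro _ ⟨σ, hσ, rfl⟩ _ ⟨τ, hτ, rfl⟩
  have hσ' := tendsto_endpointProduct_of_asymptotic (asymptotic_of_endpoint_eq hσ.symm)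
  have hτ' := tendsto_endpointProduct_of_asymptotic (asymptotic_of_endpoint_eq hτ.symm)
  exact (hX.tendsto_gromovProduct γ (hσ'.comp tendsto_fst)
    (hτ'.comp tendsto_snd)).eventually_ge_atTop R

theorem basicNhd_subset_of_bdry_mem {η ζ : GromovBoundary X} {p : X} {R : ℝ}
    (hζ : .bdry ζ ∈ basicNhd η p (R + κ)) : basicNhd ζ p (R + κ) ⊆ basicNhd η p R := by
  intro z hz σ hσ ρ hρ
  obtain ⟨τ, hτ⟩ := exists_endpoint_eq ζ
  obtain ⟨a, ha, b, hb, hστ⟩ := eventually_prod_iff.1 (hz σ hσ τ ⟨τ, hτ, rfl⟩)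
  obtain ⟨c, hc, d, hd, hτρ⟩ := eventually_prod_iff.1 (hζ τ ⟨τ, hτ, rfl⟩ ρ hρ)
  obtain ⟨u, hub, huc⟩ := (hb.and hc).exists
  filter_upwards [ha.prod_mk hd] with st hst
  linarith [hX p (σ st.1) (τ u) (ρ st.2), le_min (hστ hst.1 hub) (hτρ huc hst.2)]

theorem nhds_bdry (η : GromovBoundary X) :
    𝓝 (GromovCompactification.bdry η) = gromovNhds (.bdry η) := by
  refine TopologicalSpace.nhds_mkOfNhds _ _ ?_ ?_
  · rintro (x | ξ)
    · rw [gromovNhds, ← Filter.map_pure]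
      exact map_mono (pure_le_nhds x)
    · obtain ⟨γ, rfl⟩ := exists_endpoint_eq ξ
      intro s hs
      obtain ⟨R, -, hR⟩ := (hasBasis_gromovNhds_bdry _ (γ 0)).mem_iff.1 hs
      exact hR (hX.bdry_mem_basicNhd γ R)
  · rintro (x | ξ) s hs
    · exact eventually_eventually_nhds.2 (show ∀ᶠ y in 𝓝 x, .point y ∈ s from hs)
    · obtain ⟨γ, rfl⟩ := exists_endpoint_eq ξ
      obtain ⟨R, -, hR⟩ := (hasBasis_gromovNhds_bdry _ (γ 0)).mem_iff.1 hs
      have hnhd (C : ℝ) : basicNhd γ.endpoint (γ 0) (R + C) ∈ gromovNhds (.bdry γ.endpoint) :=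
        (hasBasis_gromovNhds_bdry γ.endpoint (γ 0)).mem_of_mem trivial
      filter_upwards [hnhd κ, hnhd 1]
      rintro (x | ζ) hκ hone
      · refine mem_map.2 (mem_of_superset (Metric.closedBall_mem_nhds x one_pos) fun y hy => hR ?_)
        exact (point_mem_basicNhd_of_dist_le hone (Metric.mem_closedBall'.1 hy))
      · exact mem_of_superset ((hasBasis_gromovNhds_bdry ζ (γ 0)).mem_of_mem trivial)
          ((hX.basicNhd_subset_of_bdry_mem hκ).trans hR)

theorem toBoundary_endpoint (γ : GeodesicRay X) :
    toBoundary γ.endpoint = comap γ.endpointProduct atTop := by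
  have hbasis := (hasBasis_gromovNhds_bdry γ.endpoint (γ 0)).comap GromovCompactification.point
  rw [toBoundary, hX.nhds_bdry]
  refine hbasis.ext (atTop_basis.comap _) (fun R _ => ⟨R + κ, trivial, fun x hx => ?_⟩)
    fun R _ => ⟨R, trivial, fun x hx => ?_⟩
  · refine point_mem_basicNhd_iff.2 fun σ hσ => ?_
    have hlim := tendsto_endpointProduct_of_asymptotic (asymptotic_of_endpoint_eq hσ.symm)
    filter_upwards [hlim.eventually_ge_atTop (R + κ)] with t ht
    linarith [le_min hx ht, hX.min_endpointProduct_le_gromovProduct γ x (σ t)]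
  · obtain ⟨t, ht⟩ := (point_mem_basicNhd_iff.1 hx γ rfl).exists
    exact ht.trans (γ.gromovProduct_le_endpointProduct x t)

theorem tendsto_toBoundary_iff {ι : Type*} {l : Filter ι} {u : ι → X} (γ : GeodesicRay X) :
    Tendsto u l (toBoundary γ.endpoint) ↔
      Tendsto (fun i => γ.endpointProduct (u i)) l atTop := by
  rw [hX.toBoundary_endpoint, tendsto_comap_iff, Function.comp_def]

theorem tendsto_ray (γ : GeodesicRay X) : Tendsto γ atTop (toBoundary γ.endpoint) :=
  (hX.tendsto_toBoundary_iff γ).2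
    (tendsto_endpointProduct_of_asymptotic (asymptotic_of_endpoint_eq rfl))

theorem tendsto_toBoundary_of_dist_le {ι : Type*} {l : Filter ι} {u v : ι → X}
    {η : GromovBoundary X} {C : ℝ} (hu : Tendsto u l (toBoundary η))
    (huv : ∀ᶠ i in l, dist (u i) (v i) ≤ C) : Tendsto v l (toBoundary η) := by
  obtain ⟨γ, rfl⟩ := exists_endpoint_eq η
  rw [hX.tendsto_toBoundary_iff] at hu ⊢
  refine tendsto_atTop_mono' l ?_ (tendsto_atTop_add_const_right l (-C) hu)
  filter_upwards [huv] with i hi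
  linarith [γ.endpointProduct_le_add_dist (u i) (v i)]

theorem tendsto_dist_of_tendsto_toBoundary {ι : Type*} {l : Filter ι} {u : ι → X}
    (γ : GeodesicRay X) (hu : Tendsto u l (toBoundary γ.endpoint)) :
    Tendsto (fun i => dist (u i) (γ 0)) l atTop :=
  tendsto_atTop_mono (fun _ => γ.endpointProduct_le_dist _) ((hX.tendsto_toBoundary_iff γ).1 hu)

end IsFourPointHyperbolic

end Compactification

section QuasiGeodesic

theorem GeodesicRay.isQuasiGeodesicRay (γ : GeodesicRay X) : IsQuasiGeodesicRay 1 0 γ := by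
  intro s t
  simp [γ.dist_eq, abs_sub_comm]

theorem IsQuasiGeodesicRay.of_dist_le {A B C : ℝ} {c c' : ℝ≥0 → X} (hc : IsQuasiGeodesicRay A B c)
    (hcc' : ∀ t, dist (c t) (c' t) ≤ C) : IsQuasiGeodesicRay A (B + 2 * C) c' := by
  intro s t
  obtain ⟨hlower, hupper⟩ := hc s t
  have hle := dist_triangle4_left (c s) (c t) (c' s) (c' t)
  have hge := dist_triangle4_right (c s) (c t) (c' s) (c' t)
  constructor <;> linarith [hcc' s, hcc' t]

end QuasiGeodesic

section GeodesicLimit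

theorem mem_geodesicRegion (γ : GeodesicRay X) (t : ℝ≥0) {R : ℝ} (hR : 0 < R) :
    γ t ∈ geodesicRegion γ R :=
  (Metric.infDist_zero_of_mem (mem_range_self t)).trans_lt hR

theorem exists_dist_le_of_mem_geodesicRegion {γ σ : GeodesicRay X} (h : Asymptotic γ σ) (R : ℝ) :
    ∃ C : ℝ, ∀ x ∈ geodesicRegion σ R, ∃ t, dist x (γ t) ≤ C := by
  obtain ⟨K, hK⟩ := h
  refine ⟨R + K, fun x hx => ?_⟩
  obtain ⟨_, ⟨t, rfl⟩, ht⟩ := (Metric.infDist_lt_iff (range_nonempty _)).1 hx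
  exact ⟨t, by linarith [dist_triangle_right x (γ t) (σ t), hK t]⟩

theorem HasGeodesicLimit.tendsto_ray {Z : Type*} [TopologicalSpace Z] {κ : ℝ}
    (hX : IsFourPointHyperbolic X κ) {F : X → Z} {ξ : Z} (γ : GeodesicRay X)
    (h : HasGeodesicLimit F γ.endpoint ξ) : Tendsto (fun t => F (γ t)) atTop (𝓝 ξ) :=
  tendsto_of_seq_tendsto fun _ ht =>
    h _ (tendsto_comap_iff.1 ((hX.tendsto_ray γ).comp ht))
      ⟨γ, 1, rfl, one_pos, fun _ => mem_geodesicRegion γ _ one_pos⟩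

theorem hasGeodesicLimit_of_tendsto_ray {κ κ' : ℝ} (hX : IsFourPointHyperbolic X κ)
    (hY : IsFourPointHyperbolic Y κ') {L : ℝ≥0} {f : X → Y} (hf : LipschitzWith L f)
    (γ : GeodesicRay X) {ξ : GromovBoundary Y}
    (h : Tendsto (fun t => f (γ t)) atTop (toBoundary ξ)) :
    HasGeodesicLimit (fun x => GromovCompactification.point (f x)) γ.endpoint (.bdry ξ) := by
  rintro x hx ⟨σ, R, hσ, -, hR⟩
  obtain ⟨C, hC⟩ := exists_dist_le_of_mem_geodesicRegion (asymptotic_of_endpoint_eq hσ.symm) R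
  choose t ht using fun n => hC (x n) (hR n)
  have ht_atTop : Tendsto t atTop atTop := by
    have hdist := hX.tendsto_dist_of_tendsto_toBoundary γ (tendsto_comap_iff.2 hx)
    refine NNReal.tendsto_coe_atTop.1 (tendsto_atTop_mono (fun n => ?_)
      (tendsto_atTop_add_const_right atTop (-C) hdist))
    linarith [ht n, dist_triangle (x n) (γ (t n)) (γ 0), γ.dist_zero (t n)]
  have hfx : Tendsto (fun n => f (x n)) atTop (toBoundary ξ) :=
    hY.tendsto_toBoundary_of_dist_le (h.comp ht_atTop) (.of_forall fun n =>
      hf.dist_le_mul_of_le ((dist_comm _ _).trans_le (ht n)))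
  exact tendsto_comap_iff.1 hfx

end GeodesicLimit

section Dilation

theorem liminf_coe_lt_top_iff {α : Type*} {l : Filter α} {u : α → ℝ} :
    liminf (fun a => (u a : EReal)) l < ⊤ ↔ ∃ C : ℝ, ∃ᶠ a in l, u a ≤ C := by
  constructor
  · intro h
    obtain ⟨C, hC, -⟩ := EReal.lt_iff_exists_real_btwn.1 h
    exact ⟨C, (frequently_lt_of_liminf_lt (by isBoundedDefault) hC).mono
      fun a ha => (EReal.coe_lt_coe_iff.1 ha).le⟩
  · rintro ⟨C, hC⟩
    exact (liminf_le_of_frequently_le' (hC.mono fun a ha => EReal.coe_le_coe_iff.2 ha)).trans_lt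
      (EReal.coe_lt_top C)

theorem limsup_coe_lt_top_of_le {α : Type*} {l : Filter α} {u : α → ℝ} {C : ℝ}
    (h : ∀ a, u a ≤ C) : limsup (fun a => (u a : EReal)) l < ⊤ :=
  (limsup_le_of_le (by isBoundedDefault)
    (.of_forall fun a => EReal.coe_le_coe_iff.2 (h a))).trans_lt (EReal.coe_lt_top C)

theorem dilation_lt_top_iff {f : X → X} {η : GromovBoundary X} {p : X} :
    dilation f η p < ⊤ ↔ ∃ C : ℝ, ∃ᶠ z in toBoundary η, dist z p - dist (f z) p ≤ C :=
  EReal.exp_lt_top_iff.trans liminf_coe_lt_top_iff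

theorem dilation_lt_top_of_isQuasiGeodesicRay {κ : ℝ} (hX : IsFourPointHyperbolic X κ) {f : X → X}
    (γ : GeodesicRay X) {B : ℝ} (hB : IsQuasiGeodesicRay 1 B fun t => f (γ t)) (p : X) :
    dilation f γ.endpoint p < ⊤ := by
  refine dilation_lt_top_iff.2 ⟨dist (γ 0) p + dist (f (γ 0)) p + B,
    (hX.tendsto_ray γ).frequently (Frequently.of_forall fun t => ?_)⟩
  have hlower := (hB 0 t).1
  rw [inv_one, one_mul, NNReal.coe_zero, sub_zero, NNReal.abs_eq] at hlower
  linarith [dist_triangle_right (f (γ 0)) (f (γ t)) p, dist_triangle (γ t) (γ 0) p, γ.dist_zero t]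

end Dilation

section NonExpanding

variable {κ κ' : ℝ} {f : X → Y}

theorem le_gromovProduct_map_ray (hX : IsFourPointHyperbolic X κ) (hf : LipschitzWith 1 f)
    (γ : GeodesicRay X) {z : X} {t : ℝ≥0} (hz : t ≤ γ.endpointProduct z) (q : Y) :
    t - 2 * κ - (dist z (γ 0) - dist (f z) q) ≤ gromovProduct q (f z) (f (γ t)) := by
  have hdist := hX.dist_ray_le γ z t
  rw [min_eq_right hz] at hdist
  have hmap := hf.dist_le_mul z (γ t)
  rw [NNReal.coe_one, one_mul] at hmap
  have hprod := dist_sub_dist_le_gromovProduct q (f (γ t)) (f z)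
  rw [dist_comm (f (γ t)), gromovProduct_comm] at hprod
  linarith

theorem tendsto_map_toBoundary (hX : IsFourPointHyperbolic X κ) (hY : IsFourPointHyperbolic Y κ')
    (hf : LipschitzWith 1 f) (γ : GeodesicRay X) (σ : GeodesicRay Y)
    (hγ : Tendsto (fun t => f (γ t)) atTop (toBoundary σ.endpoint)) {ι : Type*} {l : Filter ι}
    {z : ι → X} (hz : Tendsto z l (toBoundary γ.endpoint)) {C : ℝ}
    (hC : ∀ᶠ i in l, dist (z i) (γ 0) - dist (f (z i)) (σ 0) ≤ C) :
    Tendsto (fun i => f (z i)) l (toBoundary σ.endpoint) := by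
  rw [hX.tendsto_toBoundary_iff] at hz
  rw [hY.tendsto_toBoundary_iff] at hγ ⊢
  refine tendsto_atTop.2 fun R => ?_
  have hcoe : Tendsto ((↑) : ℝ≥0 → ℝ) atTop atTop := NNReal.tendsto_coe_atTop.2 tendsto_id
  obtain ⟨t, hfγ, ht⟩ := ((hγ.eventually_ge_atTop (R + κ')).and
    (hcoe.eventually_ge_atTop (R + κ' + 2 * κ + C))).exists
  filter_upwards [hz.eventually_ge_atTop t, hC] with i hzt hzC
  have hprod : R + κ' ≤ gromovProduct (σ 0) (f (z i)) (f (γ t)) := by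
    linarith [le_gromovProduct_map_ray hX hf γ hzt (σ 0)]
  linarith [hY.min_gromovProduct_le_endpointProduct σ (f (z i)) (f (γ t)), le_min hprod hfγ]

theorem dist_ray_map_ray_le (hX : IsFourPointHyperbolic X κ) (hY : IsFourPointHyperbolic Y κ')
    (hf : LipschitzWith 1 f) (γ : GeodesicRay X) (σ : GeodesicRay Y) {z : X} {t : ℝ≥0} {C : ℝ}
    (hC₀ : 0 ≤ C) (hz : t ≤ γ.endpointProduct z) (hfz : t ≤ σ.endpointProduct (f z))
    (hC : dist z (γ 0) - dist (f z) (σ 0) ≤ C) :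
    dist (f (γ t)) (σ t) ≤ dist (f (γ 0)) (σ 0) + 2 * C + 4 * κ + 4 * κ' := by
  have hκ := hX.nonneg (γ 0)
  have hκ' := hY.nonneg (σ 0)
  have hprod := le_gromovProduct_map_ray hX hf γ hz (σ 0)
  rw [gromovProduct_comm] at hprod
  have hend : t - (C + 2 * κ + κ') ≤ σ.endpointProduct (f (γ t)) := by
    have hmin : t - (C + 2 * κ) ≤
        min (gromovProduct (σ 0) (f (γ t)) (f z)) (σ.endpointProduct (f z)) :=
      le_min (by linarith) (by linarith)
    linarith [hY.min_gromovProduct_le_endpointProduct σ (f (γ t)) (f z)]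
  have hmin : t - (C + 2 * κ + κ') ≤ min (σ.endpointProduct (f (γ t))) t :=
    le_min hend (by linarith)
  have horigin := hf.dist_le_mul (γ t) (γ 0)
  rw [NNReal.coe_one, one_mul, γ.dist_zero] at horigin
  linarith [hY.dist_ray_le σ (f (γ t)) t, dist_triangle (f (γ t)) (f (γ 0)) (σ 0)]

theorem exists_dist_ray_map_ray_le (hX : IsFourPointHyperbolic X κ)
    (hY : IsFourPointHyperbolic Y κ') (hf : LipschitzWith 1 f) (γ : GeodesicRay X)
    (σ : GeodesicRay Y) {ι : Type*} {l : Filter ι} [l.NeBot] {z : ι → X}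
    (hz : Tendsto z l (toBoundary γ.endpoint))
    (hfz : Tendsto (fun i => f (z i)) l (toBoundary σ.endpoint)) {C : ℝ}
    (hC : ∀ᶠ i in l, dist (z i) (γ 0) - dist (f (z i)) (σ 0) ≤ C) :
    ∃ C' : ℝ, ∀ t, dist (σ t) (f (γ t)) ≤ C' := by
  rw [hX.tendsto_toBoundary_iff] at hz
  rw [hY.tendsto_toBoundary_iff] at hfz
  refine ⟨dist (f (γ 0)) (σ 0) + 2 * max C 0 + 4 * κ + 4 * κ', fun t => ?_⟩
  obtain ⟨i, hzt, hfzt, hzC⟩ :=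
    ((hz.eventually_ge_atTop t).and ((hfz.eventually_ge_atTop t).and hC)).exists
  rw [dist_comm]
  exact dist_ray_map_ray_le hX hY hf γ σ (le_max_right C 0) hzt hfzt (hzC.trans (le_max_left C 0))

end NonExpanding

section BoundaryRegularFixedPoint

theorem exists_neBot_le_eventually_of_frequently {α : Type*} {l : Filter α} {p : α → Prop}
    (h : ∃ᶠ a in l, p a) : ∃ l' ≤ l, l'.NeBot ∧ ∀ᶠ a in l', p a :=
  ⟨l ⊓ 𝓟 {a | p a}, inf_le_left, frequently_iff_neBot.1 h,
    eventually_inf_principal.2 (.of_forall fun _ => id)⟩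

variable {κ : ℝ} (hX : IsFourPointHyperbolic X κ) {f : X → X} (γ : GeodesicRay X)
include hX

theorem IsBRFP.exists_dist_ray_map_le (hf : LipschitzWith 1 f) (h : IsBRFP f γ.endpoint) :
    ∃ C : ℝ, ∀ t, dist (γ t) (f (γ t)) ≤ C := by
  obtain ⟨C, hC⟩ := dilation_lt_top_iff.1 (h.1 (γ 0))
  obtain ⟨l, hl, _, hzC⟩ := exists_neBot_le_eventually_of_frequently hC
  have hz : Tendsto id l (toBoundary γ.endpoint) := tendsto_id'.2 hl
  have hfγ : Tendsto (fun t => f (γ t)) atTop (toBoundary γ.endpoint) :=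
    tendsto_comap_iff.2 (h.2.tendsto_ray hX γ)
  exact exists_dist_ray_map_ray_le hX hX hf γ γ hz
    (tendsto_map_toBoundary hX hX hf γ γ hfγ hz hzC) hzC

theorem exists_dist_ray_map_le_of_frequently (hf : LipschitzWith 1 f) {C : ℝ}
    (h : ∃ᶠ z in toBoundary γ.endpoint, dist z (f z) ≤ C) :
    ∃ C' : ℝ, ∀ t, dist (γ t) (f (γ t)) ≤ C' := by
  obtain ⟨l, hl, _, hzC⟩ := exists_neBot_le_eventually_of_frequently h
  have hz : Tendsto id l (toBoundary γ.endpoint) := tendsto_id'.2 hl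
  exact exists_dist_ray_map_ray_le hX hX hf γ γ hz (hX.tendsto_toBoundary_of_dist_le hz hzC)
    (hzC.mono fun z hz => (sub_le_iff_le_add.2 (dist_triangle z (f z) (γ 0))).trans hz)

theorem isBRFP_of_isQuasiGeodesicRay {L : ℝ≥0} (hf : LipschitzWith L f) {B : ℝ}
    (hB : IsQuasiGeodesicRay 1 B fun t => f (γ t))
    (hlim : Tendsto (fun t => f (γ t)) atTop (toBoundary γ.endpoint)) : IsBRFP f γ.endpoint :=
  ⟨dilation_lt_top_of_isQuasiGeodesicRay hX γ hB, hasGeodesicLimit_of_tendsto_ray hX hX hf γ hlim⟩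

theorem liminf_toBoundary_le_limsup_ray (u : X → EReal) :
    liminf u (toBoundary γ.endpoint) ≤ limsup (fun t => u (γ t)) atTop :=
  (liminf_le_liminf_of_le (hX.tendsto_ray γ)).trans (liminf_le_limsup (f := atTop))

end BoundaryRegularFixedPoint

end GromovHyp

theorem mainTheorem10_general {X : Type*} [MetricSpace X] {κ : ℝ}
    (hX : GromovHyp.IsFourPointHyperbolic X κ) (f : X → X) (hf : LipschitzWith 1 f)
    (η : GromovHyp.GromovBoundary X) :
    List.TFAE [
      GromovHyp.IsBRFP f η,
      ∃ γ : GromovHyp.GeodesicRay X, γ.endpoint = η ∧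
        (∃ B : ℝ, 0 ≤ B ∧ GromovHyp.IsQuasiGeodesicRay 1 B (fun t => f (γ t))) ∧
        Tendsto (fun t => GromovHyp.GromovCompactification.point (f (γ t))) atTop
          (𝓝 (GromovHyp.GromovCompactification.bdry η)),
      ∃ γ : GromovHyp.GeodesicRay X, γ.endpoint = η ∧
        limsup (fun t : ℝ≥0 => ((dist (γ t) (f (γ t)) : ℝ) : EReal)) atTop < ⊤,
      liminf (fun z : X => ((dist z (f z) : ℝ) : EReal)) (GromovHyp.toBoundary η) < ⊤] := by
  tfae_have 1 → 3 := by
    intro hη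
    obtain ⟨γ, rfl⟩ := GromovHyp.exists_endpoint_eq η
    obtain ⟨C, hC⟩ := hη.exists_dist_ray_map_le hX γ hf
    exact ⟨γ, rfl, GromovHyp.limsup_coe_lt_top_of_le hC⟩
  tfae_have 3 → 4 := by
    rintro ⟨γ, rfl, hlimsup⟩
    exact (GromovHyp.liminf_toBoundary_le_limsup_ray hX γ _).trans_lt hlimsup
  tfae_have 4 → 2 := by
    intro hliminf
    obtain ⟨γ, rfl⟩ := GromovHyp.exists_endpoint_eq η
    obtain ⟨C, hC⟩ := GromovHyp.liminf_coe_lt_top_iff.1 hliminf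
    obtain ⟨C', hC'⟩ := GromovHyp.exists_dist_ray_map_le_of_frequently hX γ hf hC
    have hC'₀ : 0 ≤ C' := dist_nonneg.trans (hC' 0)
    exact ⟨γ, rfl, ⟨0 + 2 * C', by positivity, γ.isQuasiGeodesicRay.of_dist_le hC'⟩,
      tendsto_comap_iff.1 (hX.tendsto_toBoundary_of_dist_le (hX.tendsto_ray γ) (.of_forall hC'))⟩
  tfae_have 2 → 1 := by
    rintro ⟨γ, rfl, ⟨B, -, hB⟩, hlim⟩
    exact GromovHyp.isBRFP_of_isQuasiGeodesicRay hX γ hf hB (tendsto_comap_iff.2 hlim)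
  tfae_finish

theorem mainTheorem10 {X : Type*} [MetricSpace X] [ProperSpace X]
    (hgeo : GromovHyp.IsGeodesicSpace X) (hhyp : GromovHyp.IsGromovHyperbolic X)
    (f : X → X) (hf : ∀ x y : X, dist (f x) (f y) ≤ dist x y)
    (η : GromovHyp.GromovBoundary X) :
    List.TFAE [
      GromovHyp.IsBRFP f η,
      ∃ γ : GromovHyp.GeodesicRay X, γ.endpoint = η ∧
        (∃ B : ℝ, 0 ≤ B ∧ GromovHyp.IsQuasiGeodesicRay 1 B (fun t => f (γ t))) ∧
        Tendsto (fun t => GromovHyp.GromovCompactification.point (f (γ t))) atTop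
          (𝓝 (GromovHyp.GromovCompactification.bdry η)),
      ∃ γ : GromovHyp.GeodesicRay X, γ.endpoint = η ∧
        limsup (fun t : ℝ≥0 => ((dist (γ t) (f (γ t)) : ℝ) : EReal)) atTop < ⊤,
      liminf (fun z : X => ((dist z (f z) : ℝ) : EReal)) (GromovHyp.toBoundary η) < ⊤] :=
  let ⟨_, hX⟩ := hhyp.exists_isFourPointHyperbolic hgeo
  mainTheorem10_general hX f (.mk_one hf) η
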